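/- For an integer $n\ge 3$ put $N=4n$ and $V=[n]\times\{0,1,01,11\}$, where arithmetic on $[n]$ is modulo $n$. Let $x,y\in\{0,1\}^n$ be two strings for which there is exactly one index $i\in[n]$ with $x_i>y_i$. Let $E_A\subseteq V\times V$ consist of the following directed edges, for all $i\in[n]$: \begin{itemize} \item $((i,1),(i+1,z))$, where $z=0$ if $x_{i+1}=0$ and $z=11$ otherwise; \item if $x_i=0$: $((i,0),(i+1,z))$, where $z=0$ if $x_{i+1}=0$ and $z=01$ otherwise; \item if $x_i=1$: $((i,0),(i-1,x_{i-1}))$; \item $((i,01),(i,1))$ and $((i,11),(i,1))$. \end{itemize} Let $E_B\subseteq V\times V$ consist of the following directed edges, for all $i\in[n]$: \begin{itemize} \item $((i,1),(i+1,z))$, where $z=0$ if $y_{i+1}=0$ and $z=11$ otherwise; \item $((i,0),(i+1,z))$, where $z=0$ if $y_{i+1}=0$ and $z=01$ otherwise; \item $((i,01),(i,1))$ and $((i,11),(i,1))$. \end{itemize} The $2$-cycle $N\times N$ game constructed from $x,y$ is the two-player win-lose game in which both players have the action set $V$, and in which, for $u,v\in V$, $u_A(u,v)=1$ if $(v,u)\in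 E_A$ and $u_A(u,v)=0$ otherwise, while $u_B(u,v)=1$ if $(u,v)\in E_B$ and $u_B(u,v)=0$ otherwise. A pair $(u,v)\in V\times V$ is a pure Nash equilibrium if there is an exact Nash equilibrium in mixed strategies $(a^*,b^*)$ in which $a^*$ has support $\{u\}$ and $b^*$ has support $\{v\}$. Consider randomized two-party communication protocols, with common and private random coins, in which player $A$ gets $u_A$ and player $B$ gets $u_B$, and in which at the end player $A$ outputs an action $u$ and player $B$ outputs an action $v$. Such a protocol finds the pure Nash equilibrium of the $2$-cycle $N\times N$ game with error probability at most $\frac13$ if, on the utility functions of every $2$-cycle $N\times N$ game, the pair $(u,v)$ of outputs is a pure Nash equilibrium of that game with probability at least $\frac23$. Its communication complexity is the maximal number of bits exchanged, over all such inputs and all outcomes of the coins. \textbf{Theorem.} Every $2$-cycle $N\times N$ game has exactly one pure Nash equilibrium, and every randomized communication protocol that finds the pure Nash equilibrium of the $2$-cycle $N\times N$ game with error probability at most $\frac13$ has communication complexity $\Omega(N)$. That is, there is an absolute constant $c>0$ such that, for every $n\ge 3$ and $N=4n$, every such protocol has communication complexity at least $cN$. -/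

import Mathlib

noncomputable section

namespace TwoCycle

/-! ### Win-lose games, mixed strategies and Nash equilibria -/

section Games

variable {U V : Type*}

/-- The real payoff (`0` or `1`) of a win-lose utility function. -/
def payoff (w : U → V → Bool) (u : U) (v : V) : ℝ := if w u v = true then 1 else 0

variable [Fintype U] [Fintype V]

/-- The expected payoff `E_{u ∼ a, v ∼ b} [w(u, v)]` under independent mixed strategies. -/
def expectedPayoff (w : U → V → Bool) (a : U → ℝ) (b : V → ℝ) : ℝ :=
  ∑ u, ∑ v, a u * b v * payoff w u v

/-- `(a, b)` is an `ε`-approximate Nash equilibrium of the win-lose game `(uA, uB)`.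
Mixed strategies are the elements of the standard simplex. -/
def IsApproxNash (ε : ℝ) (uA uB : U → V → Bool) (a : U → ℝ) (b : V → ℝ) : Prop :=
  a ∈ stdSimplex ℝ U ∧ b ∈ stdSimplex ℝ V ∧
    (∀ a' ∈ stdSimplex ℝ U, expectedPayoff uA a' b - expectedPayoff uA a b ≤ ε) ∧
    (∀ b' ∈ stdSimplex ℝ V, expectedPayoff uB a b' - expectedPayoff uB a b ≤ ε)

/-- `(u, v)` is a pure Nash equilibrium: there is an exact Nash equilibrium whose two mixed
strategies have supports `{u}` and `{v}`. -/
def IsPureNash (uA uB : U → V → Bool) (u : U) (v : V) : Prop :=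
  ∃ (a : U → ℝ) (b : V → ℝ), IsApproxNash 0 uA uB a b ∧
    Function.support a = {u} ∧ Function.support b = {v}

end Games

/-! ### The 2-cycle game -/

/-- The four labels `0`, `1`, `01`, `11`. -/
inductive Label : Type
  | l0 | l1 | l01 | l11
  deriving DecidableEq

instance : Fintype Label where
  elems := {Label.l0, Label.l1, Label.l01, Label.l11}
  complete := by intro z; cases z <;> simp

/-- The vertex set `[n] × {0, 1, 01, 11}`. The arithmetic of `Fin n` is arithmetic modulo `n`. -/
abbrev Vertex (n : ℕ) : Type := Fin n × Label

/-- A bit regarded as one of the labels `0`, `1`. -/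
def Label.ofBit (b : Bool) : Label := if b = false then Label.l0 else Label.l1

/-- The directed edges of the graph that player `A` computes from the string `x`. -/
def edgesA {n : ℕ} [NeZero n] (x : Fin n → Bool) : Set (Vertex n × Vertex n) :=
  {e | ∃ i : Fin n,
      e = ((i, Label.l1), (i + 1, if x (i + 1) = false then Label.l0 else Label.l11))} ∪
  {e | ∃ i : Fin n, x i = false ∧
      e = ((i, Label.l0), (i + 1, if x (i + 1) = false then Label.l0 else Label.l01))} ∪
  {e | ∃ i : Fin n, x i = true ∧
      e = ((i, Label.l0), (i - 1, Label.ofBit (x (i - 1))))} ∪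
  {e | ∃ i : Fin n, e = ((i, Label.l01), (i, Label.l1)) ∨ e = ((i, Label.l11), (i, Label.l1))}

/-- The directed edges of the graph that player `B` computes from the string `y`. -/
def edgesB {n : ℕ} [NeZero n] (y : Fin n → Bool) : Set (Vertex n × Vertex n) :=
  {e | ∃ i : Fin n,
      e = ((i, Label.l1), (i + 1, if y (i + 1) = false then Label.l0 else Label.l11))} ∪
  {e | ∃ i : Fin n,
      e = ((i, Label.l0), (i + 1, if y (i + 1) = false then Label.l0 else Label.l01))} ∪
  {e | ∃ i : Fin n, e = ((i, Label.l01), (i, Label.l1)) ∨ e = ((i, Label.l11), (i, Label.l1))}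

open Classical in
/-- Player `A`'s utility function: `u_A(u, v) = 1` iff `(v, u)` is an edge of `A`'s graph. -/
def utilityA {n : ℕ} [NeZero n] (x : Fin n → Bool) : Vertex n → Vertex n → Bool :=
  fun u v => decide ((v, u) ∈ edgesA x)

open Classical in
/-- Player `B`'s utility function: `u_B(u, v) = 1` iff `(u, v)` is an edge of `B`'s graph. -/
def utilityB {n : ℕ} [NeZero n] (y : Fin n → Bool) : Vertex n → Vertex n → Bool :=
  fun u v => decide ((u, v) ∈ edgesB y)

/-- There is exactly one disputed index, i.e. exactly one `i` with `x i > y i`. -/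
def UniquelyDisputed {n : ℕ} (x y : Fin n → Bool) : Prop := ∃! i : Fin n, x i > y i

/-- `(uA, uB)` are the utility functions of a 2-cycle game on `[n] × {0, 1, 01, 11}`. -/
def IsTwoCycleGame {n : ℕ} [NeZero n] (uA uB : Vertex n → Vertex n → Bool) : Prop :=
  ∃ x y : Fin n → Bool, UniquelyDisputed x y ∧ uA = utilityA x ∧ uB = utilityB y

/-! ### Two-party communication protocols -/

/-- A deterministic two-party protocol tree. Player `A` sees an element of `X`, player `B` an
element of `Y`. At an inner node one player sends a bit that depends on what that player sees; at
a leaf each player computes an output from the transcript (the leaf) and what that player sees. -/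
inductive ProtocolTree (X Y OA OB : Type) : Type
  | leaf (outA : X → OA) (outB : Y → OB) : ProtocolTree X Y OA OB
  | speakA (msg : X → Bool) (next : Bool → ProtocolTree X Y OA OB) : ProtocolTree X Y OA OB
  | speakB (msg : Y → Bool) (next : Bool → ProtocolTree X Y OA OB) : ProtocolTree X Y OA OB

namespace ProtocolTree

variable {X Y OA OB : Type}

/-- The outputs of the two players. -/
def run : ProtocolTree X Y OA OB → X → Y → OA × OB
  | leaf outA outB, x, y => (outA x, outB y)
  | speakA msg next, x, y => (next (msg x)).run x y
  | speakB msg next, x, y => (next (msg y)).run x y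

/-- The number of bits that are exchanged. -/
def bits : ProtocolTree X Y OA OB → X → Y → ℕ
  | leaf _ _, _, _ => 0
  | speakA msg next, x, y => (next (msg x)).bits x y + 1
  | speakB msg next, x, y => (next (msg y)).bits x y + 1

theorem exists_bits_le (T : ProtocolTree X Y OA OB) : ∃ k, ∀ x y, T.bits x y ≤ k := by
  induction T with
  | leaf outA outB => exact ⟨0, fun x y => le_rfl⟩
  | speakA msg next ih =>
    choose k hk using ih
    refine ⟨max (k true) (k false) + 1, fun x y => ?_⟩
    have h := hk (msg x) x y
    simp only [bits]
    cases hb : msg x <;> rw [hb] at h <;> omega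
  | speakB msg next ih =>
    choose k hk using ih
    refine ⟨max (k true) (k false) + 1, fun x y => ?_⟩
    have h := hk (msg y) x y
    simp only [bits]
    cases hb : msg y <;> rw [hb] at h <;> omega

end ProtocolTree

/-- A randomized two-party protocol: the players have common random coins, private random coins
of `A` and private random coins of `B`, all independent and from arbitrary probability spaces.
Each player sees his own input, the common coins and his own private coins. For each pair of
inputs, the pair of outputs is required to be a random variable. -/
structure RandomizedProtocol (X Y OA OB : Type) where
  Common : Type
  PrivA : Type
  PrivB : Type
  [measCommon : MeasurableSpace Common]
  [measA : MeasurableSpace PrivA]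
  [measB : MeasurableSpace PrivB]
  commonLaw : MeasureTheory.Measure Common
  lawA : MeasureTheory.Measure PrivA
  lawB : MeasureTheory.Measure PrivB
  [probCommon : MeasureTheory.IsProbabilityMeasure commonLaw]
  [probA : MeasureTheory.IsProbabilityMeasure lawA]
  [probB : MeasureTheory.IsProbabilityMeasure lawB]
  tree : ProtocolTree (X × Common × PrivA) (Y × Common × PrivB) OA OB
  measurable_run : ∀ (x : X) (y : Y) (o : OA × OB),
    MeasurableSet {ω : Common × PrivA × PrivB |
      tree.run (x, ω.1, ω.2.1) (y, ω.1, ω.2.2) = o}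

namespace RandomizedProtocol

variable {X Y OA OB : Type}

attribute [instance] measCommon measA measB probCommon probA probB

/-- The outcomes of all the coins. -/
abbrev Coins (P : RandomizedProtocol X Y OA OB) : Type := P.Common × P.PrivA × P.PrivB

/-- The joint law of the coins. -/
def coinLaw (P : RandomizedProtocol X Y OA OB) : MeasureTheory.Measure P.Coins :=
  P.commonLaw.prod (P.lawA.prod P.lawB)

/-- The outputs of the two players on inputs `x`, `y` and coins `ω`. -/
def output (P : RandomizedProtocol X Y OA OB) (x : X) (y : Y) (ω : P.Coins) : OA × OB :=
  P.tree.run (x, ω.1, ω.2.1) (y, ω.1, ω.2.2)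

/-- The number of bits exchanged on inputs `x`, `y` and coins `ω`. -/
def bits (P : RandomizedProtocol X Y OA OB) (x : X) (y : Y) (ω : P.Coins) : ℕ :=
  P.tree.bits (x, ω.1, ω.2.1) (y, ω.1, ω.2.2)

/-- `P` solves the search problem `R` with error probability at most `δ` on every pair of inputs
that satisfies the promise. -/
def Solves (P : RandomizedProtocol X Y OA OB) (promise : X → Y → Prop)
    (R : X → Y → OA → OB → Prop) (δ : ℝ) : Prop :=
  ∀ x y, promise x y →
    P.coinLaw.real {ω | ¬ R x y (P.output x y ω).1 (P.output x y ω).2} ≤ δ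

/-- The communication complexity of `P`: the largest number of bits exchanged on inputs that
satisfy the promise, over all outcomes of the coins. -/
def complexity (P : RandomizedProtocol X Y OA OB) (promise : X → Y → Prop) : ℕ :=
  sSup {k | ∃ x y, promise x y ∧ ∃ ω, k = P.bits x y ω}

/-- The supremum that defines `complexity` is over a bounded set. -/
theorem bits_le_complexity (P : RandomizedProtocol X Y OA OB) {promise : X → Y → Prop}
    {x : X} {y : Y} (h : promise x y) (ω : P.Coins) : P.bits x y ω ≤ P.complexity promise := by
  obtain ⟨k, hk⟩ := P.tree.exists_bits_le
  refine le_csSup ⟨k, ?_⟩ ⟨x, y, h, ω, rfl⟩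
  rintro _ ⟨x', y', _, ω', rfl⟩
  exact hk _ _

end RandomizedProtocol

end TwoCycle

end

/-! A pure Nash equilibrium is a 2-cycle formed by one edge of each graph, and the only such cycles
join `(i, 0)` to `(i - 1, x (i - 1))` with `x i > y i` (`utilities_eq_true_iff`). Reading `x` as a
set and `y` as the complement of a set `z`, finding the equilibrium means finding the single element
of `x ∩ z`.

Let each player name the index suggested by the output, but only if it lies in that player's own
set. On disjoint sets the two can never name the same index; on sets meeting in one point a correct
run makes them agree. The indicator of failure to agree (`missed`) is thus identically `1` on
disjoint pairs, has average at most `1/3` on uniquely meeting pairs for suitable coins, and is a sum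
of about `2 ^ C` rectangles for a protocol of `C` bits.

This contradicts `corruption` when `C` is small: up to an exponentially small error, a rectangle has
mass on uniquely meeting pairs proportional to its mass on disjoint pairs. To see this, split the
ground set at random into `S` and its complement, with `x ⊆ S` and `z ⊆ Sᶜ`. A large density is
unbiased at most elements (`subsetSum_le_exp_biased`), and at an element `i` unbiased for both
sides, adding `i` to both sets costs only a constant factor. Multiplying three failure functions
lowers `1/3` to `1/27`, which beats that constant. This gives `exp (n / 160) ≤ 36 * (2 ^ C * (n + 1)
^ 2) ^ 3`; small `n` only needs `C ≥ 1`. -/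

namespace TwoCycle

/-! ### Corruption bound for unique disjointness. -/

section Corruption

/-- The sum of a function over all subsets of a finite set. -/
def subsetSum {V : Type*} (f : Finset V → ℝ) (S : Finset V) : ℝ := ∑ x ∈ S.powerset, f x

theorem subsetSum_nonneg {V : Type*} {f : Finset V → ℝ} (hf : ∀ x, 0 ≤ f x) (S : Finset V) :
    0 ≤ subsetSum f S :=
  Finset.sum_nonneg fun x _ => hf x

theorem subsetSum_le_two_pow {V : Type*} {f : Finset V → ℝ} (hf : ∀ x, f x ≤ 1) (S : Finset V) :
    subsetSum f S ≤ 2 ^ S.card := by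
  calc subsetSum f S ≤ ∑ _x ∈ S.powerset, (1 : ℝ) := Finset.sum_le_sum fun x _ => hf x
    _ = 2 ^ S.card := by simp [Finset.card_powerset]

variable {V : Type*} [DecidableEq V]

theorem subsetSum_insert (f : Finset V → ℝ) {i : V} {S : Finset V} (hi : i ∉ S) :
    subsetSum f (insert i S) = subsetSum f S + subsetSum (fun x => f (insert i x)) S :=
  Finset.sum_powerset_insert hi f

/-- Under the density `f` on the subsets of `S`, membership of `i` has probability at least `3/4`
or at most `1/4`. -/
def IsBiased (f : Finset V → ℝ) (S : Finset V) (i : V) : Prop :=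
  3 * subsetSum f (S.erase i) ≤ subsetSum (fun x => f (insert i x)) (S.erase i) ∨
    3 * subsetSum (fun x => f (insert i x)) (S.erase i) ≤ subsetSum f (S.erase i)

open Classical in
/-- The elements of `S` at which the density `f` is biased. -/
noncomputable def biasedSet (f : Finset V → ℝ) (S : Finset V) : Finset V := S.filter (IsBiased f S)

theorem mem_biasedSet {f : Finset V → ℝ} {S : Finset V} {i : V} :
    i ∈ biasedSet f S ↔ i ∈ S ∧ IsBiased f S i := by
  simp [biasedSet]

/-- The right side is `(3/4) log (3/2) + (1/4) log (1/2)`, the gain at one element when a 3:1 bias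
is tested against the tilt `3/2`, `1/2`. -/
theorem log_tilt_ge : (1 : ℝ) / 8 ≤ (3 * Real.log (3 / 2) - Real.log 2) / 4 := by
  have h1 : 3 * Real.log (3 / 2) - Real.log 2 = Real.log (27 / 16) := by
    rw [show (27 / 16 : ℝ) = (3 / 2) ^ 3 / 2 by norm_num,
      Real.log_div (x := (3 / 2) ^ 3) (by norm_num) (by norm_num), Real.log_pow]
    norm_num
  have h2 : (1 / 2 : ℝ) ≤ Real.log (27 / 16) := by
    have h3 : (1 : ℝ) ≤ Real.log ((27 / 16) ^ 2) := by
      rw [Real.le_log_iff_exp_le (by norm_num)]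
      have := Real.exp_one_lt_d9
      norm_num at this ⊢
      linarith
    rw [Real.log_pow] at h3
    push_cast at h3
    linarith
  rw [h1]
  linarith

theorem tilt_sum_ge {a b : ℝ} (h : 3 * a ≤ b) (ha : 0 ≤ a) :
    1 / 8 * (a + b) ≤ b * Real.log (3 / 2) + a * Real.log (1 / 2) := by
  have h1 := log_tilt_ge
  have h2 : Real.log (1 / 2) = -Real.log 2 := by rw [one_div, Real.log_inv]
  have h3 : 0 ≤ Real.log 2 := Real.log_nonneg (by norm_num)
  have h4 : 0 ≤ Real.log (3 / 2) := Real.log_nonneg (by norm_num)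
  rw [h2]
  nlinarith [mul_nonneg (sub_nonneg.2 h) (add_nonneg h3 h4),
    mul_le_mul_of_nonneg_right h1 (by linarith : 0 ≤ a + b)]

theorem subsetSum_mul_ite (f : Finset V → ℝ) {S : Finset V} {j : V} (hj : j ∈ S) (a b : ℝ) :
    ∑ x ∈ S.powerset, f x * (if j ∈ x then a else b) =
      subsetSum (fun x => f (insert j x)) (S.erase j) * a + subsetSum f (S.erase j) * b := by
  conv_lhs => rw [← Finset.insert_erase hj]
  rw [Finset.sum_powerset_insert (Finset.notMem_erase j S), add_comm, subsetSum, subsetSum,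
    Finset.sum_mul, Finset.sum_mul]
  congr 1
  · exact Finset.sum_congr rfl fun x _ => by simp
  · refine Finset.sum_congr rfl fun x hx => ?_
    have : j ∉ x := fun h => Finset.notMem_erase j S (Finset.mem_powerset.1 hx h)
    simp [this]

/-- A density bounded by `1` that is biased at many elements has a small total mass. -/
theorem subsetSum_le_exp_biased {f : Finset V → ℝ} (hf0 : ∀ x, 0 ≤ f x) (hf1 : ∀ x, f x ≤ 1)
    (S : Finset V) :
    subsetSum f S ≤ 2 ^ S.card * Real.exp (-((biasedSet f S).card / 8 : ℝ)) := by
  classical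
  set F0 : V → ℝ := fun j => subsetSum f (S.erase j) with hF0
  set F1 : V → ℝ := fun j => subsetSum (fun x => f (insert j x)) (S.erase j) with hF1
  have hF0n : ∀ j, 0 ≤ F0 j := fun j => subsetSum_nonneg hf0 _
  have hF1n : ∀ j, 0 ≤ F1 j := fun j => subsetSum_nonneg (fun x => hf0 _) _
  -- Product weights tilted towards the bias of `f`: `p j` for `j ∈ x`, `q j` for `j ∉ x`. As `p j +
  -- q j = 2`, the total weight stays `2 ^ S.card`, and `l` below is the logarithm of the weight.
  set p : V → ℝ := fun j =>
    if 3 * F0 j ≤ F1 j then 3 / 2 else if 3 * F1 j ≤ F0 j then 1 / 2 else 1 with hp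
  set q : V → ℝ := fun j =>
    if 3 * F0 j ≤ F1 j then 1 / 2 else if 3 * F1 j ≤ F0 j then 3 / 2 else 1 with hq
  have hp0 : ∀ j, 0 < p j := fun j => by simp only [hp]; split_ifs <;> norm_num
  have hq0 : ∀ j, 0 < q j := fun j => by simp only [hq]; split_ifs <;> norm_num
  have hpq : ∀ j, p j + q j = 2 := fun j => by simp only [hp, hq]; split_ifs <;> norm_num
  have hstep : ∀ j ∈ S, (if j ∈ biasedSet f S then (1 : ℝ) / 8 else 0) * subsetSum f S ≤
      F1 j * Real.log (p j) + F0 j * Real.log (q j) := by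
    intro j hj
    have hsum : subsetSum f S = F0 j + F1 j := by
      conv_lhs => rw [← Finset.insert_erase hj]
      exact subsetSum_insert f (Finset.notMem_erase j S)
    rw [hsum]
    by_cases h1 : 3 * F0 j ≤ F1 j
    · have hb : j ∈ biasedSet f S := mem_biasedSet.2 ⟨hj, Or.inl h1⟩
      simp only [hp, hq, hb, h1, if_true]
      exact tilt_sum_ge h1 (hF0n j)
    · by_cases h2 : 3 * F1 j ≤ F0 j
      · have hb : j ∈ biasedSet f S := mem_biasedSet.2 ⟨hj, Or.inr h2⟩
        simp only [hp, hq, hb, h1, h2, if_true, if_false]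
        have := tilt_sum_ge h2 (hF1n j)
        linarith
      · have hb : j ∉ biasedSet f S := fun hb => by
          rcases (mem_biasedSet.1 hb).2 with h | h
          · exact h1 h
          · exact h2 h
        simp [hp, hq, hb, h1, h2]
  set t : ℝ := (biasedSet f S).card / 8 with ht
  set l : Finset V → ℝ :=
    fun x => ∑ j ∈ S, if j ∈ x then Real.log (p j) else Real.log (q j) with hl
  have hw : ∑ x ∈ S.powerset, Real.exp (l x) = 2 ^ S.card := by
    rw [show (2 : ℝ) ^ S.card = ∏ j ∈ S, (p j + q j) by simp [hpq], Finset.prod_add]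
    refine Finset.sum_congr rfl fun x hx => ?_
    have hx' := Finset.mem_powerset.1 hx
    rw [hl, Real.exp_sum, ← Finset.prod_sdiff hx', mul_comm]
    congr 1
    · exact Finset.prod_congr rfl fun j hj => by rw [if_pos hj, Real.exp_log (hp0 j)]
    · exact Finset.prod_congr rfl fun j hj => by
        rw [if_neg (Finset.mem_sdiff.1 hj).2, Real.exp_log (hq0 j)]
  -- Each biased element adds at least `1/8` to the `f`-average of `l`, and the others add nothing.
  have hfl : t * subsetSum f S ≤ ∑ x ∈ S.powerset, f x * l x := by
    have h1 : ∑ x ∈ S.powerset, f x * l x =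
        ∑ j ∈ S, (F1 j * Real.log (p j) + F0 j * Real.log (q j)) := by
      simp only [hl, Finset.mul_sum]
      rw [Finset.sum_comm]
      exact Finset.sum_congr rfl fun j hj => subsetSum_mul_ite f hj _ _
    rw [h1]
    refine le_trans (le_of_eq ?_) (Finset.sum_le_sum hstep)
    rw [← Finset.sum_mul, ← Finset.sum_filter, Finset.sum_const]
    have : S.filter (fun j => j ∈ biasedSet f S) = biasedSet f S := by
      ext j
      simp only [Finset.mem_filter, mem_biasedSet]
      tauto
    rw [this, ht, nsmul_eq_mul]
    ring
  have hmain : Real.exp t * subsetSum f S ≤ 2 ^ S.card := by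
    rw [← hw]
    calc Real.exp t * subsetSum f S
        -- The added bracket is nonnegative by `hfl`; it turns the summand into the tangent line of
        -- `exp` at `t`, evaluated at `l x`.
        ≤ Real.exp t * (subsetSum f S + (∑ x ∈ S.powerset, f x * l x - t * subsetSum f S)) := by
          gcongr
          linarith
      _ = ∑ x ∈ S.powerset, f x * (Real.exp t * (l x - t + 1)) := by
          simp only [subsetSum, Finset.mul_sum, ← Finset.sum_add_distrib, ← Finset.sum_sub_distrib]
          exact Finset.sum_congr rfl fun x _ => by ring
      _ ≤ ∑ x ∈ S.powerset, Real.exp (l x) := by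
          refine Finset.sum_le_sum fun x _ => ?_
          have h1 : Real.exp t * (l x - t + 1) ≤ Real.exp (l x) := by
            calc Real.exp t * (l x - t + 1) ≤ Real.exp t * Real.exp (l x - t) := by
                  gcongr
                  exact Real.add_one_le_exp _
              _ = Real.exp (l x) := by rw [← Real.exp_add]; congr 1; ring
          calc f x * (Real.exp t * (l x - t + 1)) ≤ f x * Real.exp (l x) :=
                mul_le_mul_of_nonneg_left h1 (hf0 x)
            _ ≤ 1 * Real.exp (l x) := mul_le_mul_of_nonneg_right (hf1 x) (Real.exp_pos _).le
            _ = Real.exp (l x) := one_mul _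
  rw [Real.exp_neg, ← div_eq_mul_inv, le_div_iff₀ (Real.exp_pos t)]
  linarith

variable [Fintype V]

/-- The sum of `F` over all triples `(S, x, z)` with `x ⊆ S` and `z ⊆ Sᶜ`. -/
def disjSum (F : Finset V → Finset V → ℝ) : ℝ :=
  ∑ S : Finset V, ∑ x ∈ S.powerset, ∑ z ∈ Sᶜ.powerset, F x z

/-- The sum of `F` over all pairs that arise from disjoint pairs `x ⊆ S`, `z ⊆ Sᶜ` of sets that
avoid an element `i` by adding `i` to both sets. -/
def meetSum (F : Finset V → Finset V → ℝ) : ℝ :=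
  ∑ i, ∑ S ∈ (Finset.univ.erase i).powerset, ∑ x ∈ S.powerset, ∑ z ∈ (insert i S)ᶜ.powerset,
    F (insert i x) (insert i z)

theorem disjSum_mul (f g : Finset V → ℝ) :
    disjSum (fun x z => f x * g z) = ∑ S, subsetSum f S * subsetSum g Sᶜ := by
  simp only [disjSum, subsetSum, Finset.sum_mul_sum]

theorem meetSum_mul (f g : Finset V → ℝ) :
    meetSum (fun x z => f x * g z) = ∑ i, ∑ S ∈ (Finset.univ.erase i).powerset,
      subsetSum (fun x => f (insert i x)) S * subsetSum (fun z => g (insert i z)) (insert i S)ᶜ := by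
  simp only [meetSum, subsetSum, Finset.sum_mul_sum]

theorem sum_finset_eq_sum_erase (h : Finset V → ℝ) (i : V) :
    ∑ S, h S = ∑ S ∈ (Finset.univ.erase i).powerset, h S +
      ∑ S ∈ (Finset.univ.erase i).powerset, h (insert i S) := by
  rw [← Finset.sum_powerset_insert (Finset.notMem_erase i _), Finset.insert_erase
    (Finset.mem_univ i), Finset.powerset_univ]

/-- Either at most `n / 20` elements are biased, or the mass of `f` is small by the exponent `n /
(20 * 8) = n / 160`. The threshold `1/20` is set by `corruption`, where ten such terms may cost at
most half of `n * disjSum`. -/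
theorem mul_card_biasedSet_le {f g : Finset V → ℝ} (hf0 : ∀ x, 0 ≤ f x) (hf1 : ∀ x, f x ≤ 1)
    (hg0 : ∀ x, 0 ≤ g x) (hg1 : ∀ x, g x ≤ 1) (T : Finset V) :
    subsetSum f T * subsetSum g Tᶜ * (biasedSet f T).card ≤
      subsetSum f T * subsetSum g Tᶜ * (Fintype.card V / 20) +
        Fintype.card V * (2 ^ Fintype.card V * Real.exp (-(Fintype.card V / 160))) := by
  have hA := subsetSum_nonneg hf0 T
  have hB := subsetSum_nonneg hg0 Tᶜ
  by_cases hc : ((biasedSet f T).card : ℝ) ≤ Fintype.card V / 20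
  · have : 0 ≤ (Fintype.card V : ℝ) *
        (2 ^ Fintype.card V * Real.exp (-(Fintype.card V / 160))) := by positivity
    have := mul_le_mul_of_nonneg_left hc (mul_nonneg hA hB)
    linarith
  · push Not at hc
    have h1 : subsetSum f T ≤ 2 ^ T.card * Real.exp (-(Fintype.card V / 160)) := by
      refine (subsetSum_le_exp_biased hf0 hf1 T).trans
        (mul_le_mul_of_nonneg_left (Real.exp_le_exp.2 ?_) (by positivity))
      linarith
    have h2 : subsetSum f T * subsetSum g Tᶜ ≤
        2 ^ Fintype.card V * Real.exp (-(Fintype.card V / 160)) := by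
      calc subsetSum f T * subsetSum g Tᶜ
          ≤ (2 ^ T.card * Real.exp (-(Fintype.card V / 160))) * 2 ^ Tᶜ.card :=
            mul_le_mul h1 (subsetSum_le_two_pow hg1 _) hB (by positivity)
        _ = (2 ^ T.card * 2 ^ Tᶜ.card) * Real.exp (-(Fintype.card V / 160)) := by ring
        _ = _ := by rw [← pow_add, Finset.card_add_card_compl]
    have h3 : ((biasedSet f T).card : ℝ) ≤ Fintype.card V := by
      exact_mod_cast Finset.card_le_univ _
    have h4 := mul_le_mul h2 h3 (by positivity) (by positivity)
    have h5 : 0 ≤ subsetSum f T * subsetSum g Tᶜ * (Fintype.card V / 20) := by positivity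
    linarith

theorem sum_sum_biased_le {f g : Finset V → ℝ} (hf0 : ∀ x, 0 ≤ f x) (hf1 : ∀ x, f x ≤ 1)
    (hg0 : ∀ x, 0 ≤ g x) (hg1 : ∀ x, g x ≤ 1) :
    ∑ i, ∑ T, (if i ∈ biasedSet f T then subsetSum f T * subsetSum g Tᶜ else 0) ≤
      Fintype.card V / 20 * disjSum (fun x z => f x * g z) +
        Fintype.card V * 4 ^ Fintype.card V * Real.exp (-(Fintype.card V / 160)) := by
  rw [Finset.sum_comm, disjSum_mul, Finset.mul_sum]
  have h1 : (Fintype.card V * 4 ^ Fintype.card V * Real.exp (-(Fintype.card V / 160)) : ℝ) =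
      ∑ _T : Finset V,
        (Fintype.card V * (2 ^ Fintype.card V * Real.exp (-(Fintype.card V / 160))) : ℝ) := by
    rw [Finset.sum_const, Finset.card_univ, Fintype.card_finset, nsmul_eq_mul]
    push_cast
    rw [show (4 : ℝ) = 2 * 2 by norm_num, mul_pow]
    ring
  rw [h1, ← Finset.sum_add_distrib]
  refine Finset.sum_le_sum fun T _ => ?_
  have h2 := mul_card_biasedSet_le hf0 hf1 hg0 hg1 T
  rw [← Finset.sum_filter, Finset.sum_const, nsmul_eq_mul]
  have h3 : (Finset.univ.filter fun i => i ∈ biasedSet f T) = biasedSet f T := by ext; simp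
  rw [h3]
  linarith

/-- Corruption bound: a rectangle that holds many disjoint pairs also holds many pairs that meet in
a single element. -/
theorem corruption {f g : Finset V → ℝ} (hf0 : ∀ x, 0 ≤ f x) (hf1 : ∀ x, f x ≤ 1)
    (hg0 : ∀ x, 0 ≤ g x) (hg1 : ∀ x, g x ≤ 1) :
    Fintype.card V / 2 * disjSum (fun x z => f x * g z) ≤
      24 * meetSum (fun x z => f x * g z) +
        10 * (Fintype.card V * 4 ^ Fintype.card V * Real.exp (-(Fintype.card V / 160))) := by
  classical
  set h : Finset V → ℝ := fun S => subsetSum f S * subsetSum g Sᶜ with hh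
  have hh0 : ∀ S, 0 ≤ h S := fun S => mul_nonneg (subsetSum_nonneg hf0 _) (subsetSum_nonneg hg0 _)
  -- Write `A0`, `A1`, `B0`, `B1` for the masses without and with `i`. The left side is `2 A0 B0 +
  -- A0 B1 + A1 B0`. If neither side is biased, `A0 < 3 A1` and `B0 < 3 B1` bound it by `(18 + 3 +
  -- 3) A1 B1`. If only `f` is biased, `B1 < 3 B0` gives `h S ≤ 4 h (insert i S)`, hence the `5`;
  -- the other case is symmetric.
  have hpoint : ∀ (i : V), ∀ S ∈ (Finset.univ.erase i).powerset,
      h S + h (insert i S) ≤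
        24 * (subsetSum (fun x => f (insert i x)) S *
            subsetSum (fun z => g (insert i z)) (insert i S)ᶜ) +
          5 * (if i ∈ biasedSet f (insert i S) then h (insert i S) else 0) +
          5 * (if i ∈ biasedSet g Sᶜ then h S else 0) := by
    intro i S hS
    have hiS : i ∉ S := fun hi => Finset.notMem_erase i _ (Finset.mem_powerset.1 hS hi)
    have hiS' : i ∈ Sᶜ := Finset.mem_compl.2 hiS
    have hcomp : Sᶜ.erase i = (insert i S)ᶜ := by
      ext j
      simp
    have hf := subsetSum_insert f hiS
    have hg : subsetSum g Sᶜ = subsetSum g (insert i S)ᶜ +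
        subsetSum (fun z => g (insert i z)) (insert i S)ᶜ := by
      rw [← hcomp]
      conv_lhs => rw [← Finset.insert_erase hiS']
      exact subsetSum_insert g (Finset.notMem_erase i _)
    have hbf : i ∈ biasedSet f (insert i S) ↔
        3 * subsetSum f S ≤ subsetSum (fun x => f (insert i x)) S ∨
          3 * subsetSum (fun x => f (insert i x)) S ≤ subsetSum f S := by
      simp [mem_biasedSet, IsBiased, Finset.erase_insert hiS]
    have hbg : i ∈ biasedSet g Sᶜ ↔
        3 * subsetSum g (insert i S)ᶜ ≤ subsetSum (fun x => g (insert i x)) (insert i S)ᶜ ∨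
          3 * subsetSum (fun x => g (insert i x)) (insert i S)ᶜ ≤ subsetSum g (insert i S)ᶜ := by
      rw [mem_biasedSet, IsBiased, hcomp]
      simp [hiS]
    simp only [hh, hf, hg, hbf, hbg]
    have a0 := subsetSum_nonneg hf0 S
    have a1 := subsetSum_nonneg (fun x => hf0 (insert i x)) S
    have b0 := subsetSum_nonneg hg0 (insert i S)ᶜ
    have b1 := subsetSum_nonneg (fun x => hg0 (insert i x)) (insert i S)ᶜ
    generalize subsetSum f S = A0 at *
    generalize subsetSum (fun x => f (insert i x)) S = A1 at *
    generalize subsetSum g (insert i S)ᶜ = B0 at *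
    generalize subsetSum (fun x => g (insert i x)) (insert i S)ᶜ = B1 at *
    have c00 := mul_nonneg a0 b0
    have c01 := mul_nonneg a0 b1
    have c10 := mul_nonneg a1 b0
    have c11 := mul_nonneg a1 b1
    split_ifs with p1 p2 p2
    · nlinarith
    · push Not at p2
      nlinarith [mul_le_mul_of_nonneg_left p2.1.le a0]
    · push Not at p1
      nlinarith [mul_le_mul_of_nonneg_right p1.1.le b0]
    · push Not at p1 p2
      nlinarith [mul_le_mul_of_nonneg_right p1.2.le b1, mul_le_mul_of_nonneg_right p1.2.le b0,
        mul_le_mul_of_nonneg_left p2.2.le a1, mul_le_mul_of_nonneg_left p2.2.le a0]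
  have htotal : Fintype.card V * disjSum (fun x z => f x * g z) =
      ∑ i, ∑ S ∈ (Finset.univ.erase i).powerset, (h S + h (insert i S)) := by
    simp_rw [Finset.sum_add_distrib]
    rw [← Finset.sum_add_distrib, disjSum_mul]
    simp_rw [← sum_finset_eq_sum_erase h]
    simp [hh]
  have hF : ∑ i, ∑ S ∈ (Finset.univ.erase i).powerset,
        (if i ∈ biasedSet f (insert i S) then h (insert i S) else 0) ≤
      ∑ i, ∑ T, (if i ∈ biasedSet f T then h T else 0) := by
    refine Finset.sum_le_sum fun i _ => ?_
    rw [sum_finset_eq_sum_erase (fun T => if i ∈ biasedSet f T then h T else 0) i]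
    refine le_add_of_nonneg_left (Finset.sum_nonneg fun S _ => ?_)
    split_ifs
    · exact hh0 S
    · exact le_rfl
  have hG : ∑ i, ∑ S ∈ (Finset.univ.erase i).powerset, (if i ∈ biasedSet g Sᶜ then h S else 0) ≤
      ∑ i, ∑ T, (if i ∈ biasedSet g T then subsetSum g T * subsetSum f Tᶜ else 0) := by
    refine Finset.sum_le_sum fun i _ => ?_
    -- Complementation exchanges the roles of `f` and `g`, so the bound for biased elements of `f`
    -- also serves `g`.
    rw [← Equiv.sum_comp (compl_involutive (α := Finset V)).toPerm
      (fun T => if i ∈ biasedSet g T then subsetSum g T * subsetSum f Tᶜ else 0),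
      sum_finset_eq_sum_erase _ i]
    refine le_add_of_le_of_nonneg (le_of_eq (Finset.sum_congr rfl fun S _ => ?_))
      (Finset.sum_nonneg fun S _ => ?_)
    · simp [hh, mul_comm]
    · split_ifs
      · exact mul_nonneg (subsetSum_nonneg hg0 _) (subsetSum_nonneg hf0 _)
      · exact le_rfl
  have hsymm : disjSum (fun x z => g x * f z) = disjSum (fun x z => f x * g z) := by
    rw [disjSum_mul, disjSum_mul, ← Equiv.sum_comp (compl_involutive (α := Finset V)).toPerm]
    simp [mul_comm]
  have h1 := sum_sum_biased_le hf0 hf1 hg0 hg1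
  have h2 := sum_sum_biased_le hg0 hg1 hf0 hf1
  have h3 : Fintype.card V * disjSum (fun x z => f x * g z) ≤ _ :=
    htotal.trans_le (Finset.sum_le_sum fun i _ => Finset.sum_le_sum (hpoint i))
  simp only [Finset.sum_add_distrib, ← Finset.mul_sum] at h3
  rw [← meetSum_mul] at h3
  rw [hsymm] at h2
  linarith

end Corruption

/-! ### Sums of rectangles. -/

section Rectangles

variable {X Y : Type*}

/-- `F` is a sum of at most `m` products of a `[0, 1]`-valued function of the first argument and
a `[0, 1]`-valued function of the second argument. -/
def IsRectSum (m : ℕ) (F : X → Y → ℝ) : Prop :=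
  ∃ (ι : Type) (_ : Fintype ι) (f : ι → X → ℝ) (g : ι → Y → ℝ), Fintype.card ι ≤ m ∧
    (∀ j x, f j x ∈ Set.Icc (0 : ℝ) 1) ∧ (∀ j y, g j y ∈ Set.Icc (0 : ℝ) 1) ∧
    ∀ x y, F x y = ∑ j, f j x * g j y

theorem isRectSum_one : IsRectSum 1 (fun (_ : X) (_ : Y) => (1 : ℝ)) :=
  ⟨Unit, inferInstance, fun _ _ => 1, fun _ _ => 1, by simp, by simp, by simp, by simp⟩

theorem IsRectSum.mono {m m' : ℕ} {F : X → Y → ℝ} (h : IsRectSum m F) (hm : m ≤ m') :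
    IsRectSum m' F := by
  obtain ⟨ι, _, f, g, hc, h⟩ := h
  exact ⟨ι, _, f, g, hc.trans hm, h⟩

theorem IsRectSum.mul {m m' : ℕ} {F G : X → Y → ℝ} (hF : IsRectSum m F) (hG : IsRectSum m' G) :
    IsRectSum (m * m') (fun x y => F x y * G x y) := by
  obtain ⟨ι, _, f, g, hc, hf, hg, hs⟩ := hF
  obtain ⟨ι', _, f', g', hc', hf', hg', hs'⟩ := hG
  refine ⟨ι × ι', inferInstance, fun j x => f j.1 x * f' j.2 x, fun j y => g j.1 y * g' j.2 y,
    ?_, fun j x => ?_, fun j y => ?_, fun x y => ?_⟩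
  · rw [Fintype.card_prod]
    exact Nat.mul_le_mul hc hc'
  · exact ⟨mul_nonneg (hf _ _).1 (hf' _ _).1, mul_le_one₀ (hf _ _).2 (hf' _ _).1 (hf' _ _).2⟩
  · exact ⟨mul_nonneg (hg _ _).1 (hg' _ _).1, mul_le_one₀ (hg _ _).2 (hg' _ _).1 (hg' _ _).2⟩
  · beta_reduce
    rw [hs, hs', Fintype.sum_mul_sum, Fintype.sum_prod_type]
    exact Finset.sum_congr rfl fun _ _ => Finset.sum_congr rfl fun _ _ => by ring

theorem IsRectSum.swap {m : ℕ} {F : X → Y → ℝ} (h : IsRectSum m F) :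
    IsRectSum m (fun y x => F x y) := by
  obtain ⟨ι, _, f, g, hc, hf, hg, hs⟩ := h
  exact ⟨ι, _, g, f, hc, hg, hf, fun y x => by simp [hs, mul_comm]⟩

theorem IsRectSum.branch {m : ℕ} {F : Bool → X → Y → ℝ} (h : ∀ b, IsRectSum m (F b))
    (msg : X → Bool) : IsRectSum (2 * m) (fun x y => F (msg x) x y) := by
  choose ι hι f g hc hf hg hs using h
  refine ⟨Σ b, ι b, inferInstance, fun j x => if msg x = j.1 then f j.1 j.2 x else 0,
    fun j y => g j.1 j.2 y, ?_, fun j x => ?_, fun j y => hg _ _ _, fun x y => ?_⟩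
  · rw [Fintype.card_sigma, Fintype.sum_bool]
    have := hc true
    have := hc false
    omega
  · beta_reduce
    split_ifs
    · exact hf _ _ _
    · simp
  · beta_reduce
    rw [Fintype.sum_sigma, Fintype.sum_bool]
    generalize msg x = c
    cases c <;> simp [hs]

/-- Each pair of candidate values is one rectangle; the verdict on that pair is put into the first
factor. -/
theorem isRectSum_ne {I : Type} [Fintype I] [DecidableEq I] (a : X → Option I) (b : Y → Option I) :
    IsRectSum ((Fintype.card I + 1) ^ 2)
      (fun x y => if a x = b y ∧ a x ≠ none then (0 : ℝ) else 1) := by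
  refine ⟨Option I × Option I, inferInstance,
    fun j x => if a x = j.1 ∧ ¬ (j.1 = j.2 ∧ j.1 ≠ none) then 1 else 0,
    fun j y => if b y = j.2 then 1 else 0, ?_, fun j x => ?_, fun j y => ?_, fun x y => ?_⟩
  · simp [sq]
  · beta_reduce
    split_ifs <;> simp
  · beta_reduce
    split_ifs <;> simp
  · rw [Finset.sum_eq_single (a x, b y)]
    · by_cases h : a x = b y ∧ a x ≠ none
      · simp [h]
      · beta_reduce
        rw [if_neg h]
        simp only [h, true_and, not_false_eq_true, if_true, mul_one]
    · rintro ⟨p, q⟩ - hpq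
      by_cases h1 : b y = q
      · have : a x ≠ p := by
          rintro rfl
          exact hpq (by rw [h1])
        simp [this]
      · simp [h1]
    · simp

end Rectangles

/-! ### Protocol trees as sums of rectangles. -/

namespace ProtocolTree

variable {X Y OA OB : Type} {X' Y' : Type*} {I : Type} [DecidableEq I]

/-- The players turn their outputs into candidates; `missed` is `0` if after at most `k` bits the
protocol ends with a common candidate, and `1` otherwise. -/
def missed (φ : X' → X) (ψ : Y' → Y) (a : X' → OA → Option I) (b : Y' → OB → Option I) :
    ℕ → ProtocolTree X Y OA OB → X' → Y' → ℝ
  | _, leaf outA outB, x, y =>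
    if a x (outA (φ x)) = b y (outB (ψ y)) ∧ a x (outA (φ x)) ≠ none then 0 else 1
  | 0, speakA _ _, _, _ => 1
  | 0, speakB _ _, _, _ => 1
  | k + 1, speakA msg next, x, y => missed φ ψ a b k (next (msg (φ x))) x y
  | k + 1, speakB msg next, x, y => missed φ ψ a b k (next (msg (ψ y))) x y

variable (φ : X' → X) (ψ : Y' → Y) (a : X' → OA → Option I) (b : Y' → OB → Option I)

/-- Each bit at most doubles the number of rectangles. The cutoff at `k` matters because disjoint
pairs violate the promise, so the tree may run longer on them than its complexity. -/
theorem isRectSum_missed [Fintype I] (T : ProtocolTree X Y OA OB) (k : ℕ) :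
    IsRectSum (2 ^ k * (Fintype.card I + 1) ^ 2) (T.missed φ ψ a b k) := by
  have hone : ∀ m : ℕ, 1 ≤ 2 ^ m * (Fintype.card I + 1) ^ 2 := fun m =>
    Nat.one_le_iff_ne_zero.2 (by positivity)
  induction T generalizing k with
  | leaf outA outB =>
    have h := isRectSum_ne (fun x => a x (outA (φ x))) (fun y => b y (outB (ψ y)))
    cases k <;> exact h.mono (Nat.le_mul_of_pos_left _ (by positivity))
  | speakA msg next ih =>
    cases k with
    | zero => exact isRectSum_one.mono (hone 0)
    | succ k =>
      exact (IsRectSum.branch (fun c => ih c k) (fun x => msg (φ x))).mono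
        (le_of_eq (by rw [pow_succ]; ring))
  | speakB msg next ih =>
    cases k with
    | zero => exact isRectSum_one.mono (hone 0)
    | succ k =>
      exact (IsRectSum.branch (fun c => (ih c k).swap) (fun y => msg (ψ y))).swap.mono
        (le_of_eq (by rw [pow_succ]; ring))

theorem missed_nonneg (T : ProtocolTree X Y OA OB) (k : ℕ) (x : X') (y : Y') :
    0 ≤ T.missed φ ψ a b k x y := by
  induction T generalizing k with
  | leaf outA outB => cases k <;> simp only [missed] <;> split_ifs <;> norm_num
  | speakA msg next ih =>
    cases k with
    | zero => simp [missed]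
    | succ k => exact ih _ k
  | speakB msg next ih =>
    cases k with
    | zero => simp [missed]
    | succ k => exact ih _ k

theorem missed_eq_one {x : X'} {y : Y'} (h : ∀ u v, a x u = b y v → a x u = none)
    (T : ProtocolTree X Y OA OB) (k : ℕ) : T.missed φ ψ a b k x y = 1 := by
  induction T generalizing k with
  | leaf outA outB => cases k <;> simp only [missed] <;> exact if_neg fun hh => hh.2 (h _ _ hh.1)
  | speakA msg next ih =>
    cases k with
    | zero => simp [missed]
    | succ k => exact ih _ k
  | speakB msg next ih =>
    cases k with
    | zero => simp [missed]
    | succ k => exact ih _ k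

theorem missed_eq_of_bits_le {x : X'} {y : Y'} (T : ProtocolTree X Y OA OB) (k : ℕ)
    (hk : T.bits (φ x) (ψ y) ≤ k) :
    T.missed φ ψ a b k x y =
      if a x (T.run (φ x) (ψ y)).1 = b y (T.run (φ x) (ψ y)).2 ∧
        a x (T.run (φ x) (ψ y)).1 ≠ none then 0 else 1 := by
  induction T generalizing k with
  | leaf outA outB => cases k <;> rfl
  | speakA msg next ih =>
    cases k with
    | zero => simp [bits] at hk
    | succ k => exact ih _ k (Nat.le_of_succ_le_succ hk)
  | speakB msg next ih =>
    cases k with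
    | zero => simp [bits] at hk
    | succ k => exact ih _ k (Nat.le_of_succ_le_succ hk)

theorem exists_eq_leaf {T : ProtocolTree X Y OA OB} {x : X} {y : Y} (h : T.bits x y = 0) :
    ∃ outA outB, T = leaf outA outB := by
  cases T with
  | leaf outA outB => exact ⟨outA, outB, rfl⟩
  | speakA msg next => simp [bits] at h
  | speakB msg next => simp [bits] at h

end ProtocolTree

/-! ### Fixing the coins by averaging. -/

namespace RandomizedProtocol

variable {X Y OA OB : Type}

instance (P : RandomizedProtocol X Y OA OB) : MeasureTheory.IsProbabilityMeasure P.coinLaw := by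
  unfold coinLaw
  infer_instance

theorem measurableSet_output [Finite OA] [Finite OB] (P : RandomizedProtocol X Y OA OB)
    (x : X) (y : Y) (Q : OA × OB → Prop) : MeasurableSet {ω | Q (P.output x y ω)} := by
  have h : {ω | Q (P.output x y ω)} = ⋃ o ∈ {o | Q o}, {ω | P.output x y ω = o} := by
    ext ω
    simp
  rw [h]
  exact MeasurableSet.biUnion (Set.toFinite _).countable fun o _ => P.measurable_run x y o

open Classical in
/-- Some outcome of the coins is at least as good as the average one on a weighted finite family of
inputs. -/
theorem exists_coins [Finite OA] [Finite OB] {P : RandomizedProtocol X Y OA OB}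
    {promise : X → Y → Prop} {R : X → Y → OA → OB → Prop} {δ : ℝ} (hP : P.Solves promise R δ)
    {ι : Type*} (s : Finset ι) (x : ι → X) (y : ι → Y) (hs : ∀ p ∈ s, promise (x p) (y p))
    {w : ι → ℝ} (hw : ∀ p ∈ s, 0 ≤ w p) :
    ∃ ω : P.Coins, ∑ p ∈ s, w p * (if R (x p) (y p) (P.output (x p) (y p) ω).1
      (P.output (x p) (y p) ω).2 then 0 else 1) ≤ δ * ∑ p ∈ s, w p := by
  set E : ι → Set P.Coins := fun p => {ω | ¬ R (x p) (y p) (P.output (x p) (y p) ω).1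
      (P.output (x p) (y p) ω).2} with hE
  have hEm : ∀ p, MeasurableSet (E p) := fun p =>
    P.measurableSet_output (x p) (y p) fun o => ¬ R (x p) (y p) o.1 o.2
  have hint : ∀ p, MeasureTheory.Integrable (fun ω => w p * (E p).indicator 1 ω) P.coinLaw :=
    fun p => ((MeasureTheory.integrable_const (1 : ℝ)).indicator (hEm p)).const_mul _
  obtain ⟨ω, hω⟩ := MeasureTheory.exists_le_integral
    (MeasureTheory.integrable_finsetSum s fun p _ => hint p)
  refine ⟨ω, le_trans (le_of_eq ?_) (hω.trans ?_)⟩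
  · refine Finset.sum_congr rfl fun p _ => ?_
    by_cases h : R (x p) (y p) (P.output (x p) (y p) ω).1 (P.output (x p) (y p) ω).2 <;>
      simp [hE, h]
  · rw [MeasureTheory.integral_finsetSum s fun p _ => hint p, Finset.mul_sum]
    refine Finset.sum_le_sum fun p hp => ?_
    rw [MeasureTheory.integral_const_mul, MeasureTheory.integral_indicator_one (hEm p), mul_comm]
    exact mul_le_mul_of_nonneg_right (hP _ _ (hs p hp)) (hw p hp)

end RandomizedProtocol

/-! ### Pure equilibria of win-lose games. -/

section PureNash

theorem payoff_le_one {U V : Type*} (w : U → V → Bool) (u : U) (v : V) : payoff w u v ≤ 1 := by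
  unfold payoff
  split_ifs <;> norm_num

variable {U V : Type*} [Fintype U] [Fintype V]

theorem eq_single_of_mem_stdSimplex [DecidableEq U] {a : U → ℝ} (ha : a ∈ stdSimplex ℝ U) {u : U}
    (hu : Function.support a = {u}) : a = Pi.single u 1 := by
  have h0 : ∀ u', u' ≠ u → a u' = 0 := fun u' h => by
    by_contra hne
    have : u' ∈ Function.support a := hne
    rw [hu] at this
    exact h this
  have h1 : a u = 1 := by
    rw [← ha.2]
    exact (Finset.sum_eq_single u (fun u' _ h => h0 u' h) (by simp)).symm
  ext u'
  by_cases h : u' = u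
  · subst h
    simp [h1]
  · simp [h0 u' h, h]

theorem expectedPayoff_single_right [DecidableEq V] (w : U → V → Bool) (a : U → ℝ) (v : V) :
    expectedPayoff w a (Pi.single v 1) = ∑ u, a u * payoff w u v := by
  refine Finset.sum_congr rfl fun u _ => ?_
  rw [Finset.sum_eq_single v] <;> simp +contextual

theorem expectedPayoff_single_left [DecidableEq U] (w : U → V → Bool) (u : U) (b : V → ℝ) :
    expectedPayoff w (Pi.single u 1) b = ∑ v, b v * payoff w u v := by
  rw [expectedPayoff, Finset.sum_eq_single u] <;> simp +contextual

theorem expectedPayoff_single [DecidableEq U] [DecidableEq V] (w : U → V → Bool) (u : U) (v : V) :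
    expectedPayoff w (Pi.single u 1) (Pi.single v 1) = payoff w u v := by
  rw [expectedPayoff_single_right, Finset.sum_eq_single u] <;> simp +contextual

theorem sum_mul_payoff_le_one {a : U → ℝ} (ha : a ∈ stdSimplex ℝ U) {r : U → ℝ}
    (hr : ∀ u, r u ≤ 1) : ∑ u, a u * r u ≤ 1 := by
  rw [← ha.2]
  exact Finset.sum_le_sum fun u _ => mul_le_of_le_one_right (ha.1 u) (hr u)

/-- If each player can always respond with payoff `1`, the pure Nash equilibria are the pairs of
actions at which both payoffs are `1`. -/
theorem isPureNash_iff {uA uB : U → V → Bool} (hA : ∀ v, ∃ u, uA u v = true)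
    (hB : ∀ u, ∃ v, uB u v = true) (u : U) (v : V) :
    IsPureNash uA uB u v ↔ uA u v = true ∧ uB u v = true := by
  classical
  constructor
  · rintro ⟨a, b, ⟨ha, hb, hA', hB'⟩, hau, hbv⟩
    obtain rfl := eq_single_of_mem_stdSimplex ha hau
    obtain rfl := eq_single_of_mem_stdSimplex hb hbv
    obtain ⟨u', hu'⟩ := hA v
    obtain ⟨v', hv'⟩ := hB u
    have h1 := hA' (Pi.single u' 1) (single_mem_stdSimplex ℝ u')
    have h2 := hB' (Pi.single v' 1) (single_mem_stdSimplex ℝ v')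
    rw [expectedPayoff_single, expectedPayoff_single] at h1 h2
    constructor
    · by_contra h
      simp only [payoff, hu', h, if_true] at h1
      norm_num at h1
    · by_contra h
      simp only [payoff, hv', h, if_true] at h2
      norm_num at h2
  · rintro ⟨h1, h2⟩
    refine ⟨Pi.single u 1, Pi.single v 1, ⟨single_mem_stdSimplex ℝ u, single_mem_stdSimplex ℝ v,
      fun a ha => ?_, fun b hb => ?_⟩, ?_, ?_⟩
    · rw [expectedPayoff_single, expectedPayoff_single_right]
      have := sum_mul_payoff_le_one ha fun u' => payoff_le_one uA u' v
      simp only [payoff, h1, if_true] at this ⊢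
      linarith
    · rw [expectedPayoff_single, expectedPayoff_single_left]
      have := sum_mul_payoff_le_one hb fun v' => payoff_le_one uB u v'
      simp only [payoff, h2, if_true] at this ⊢
      linarith
    · ext; simp
    · ext; simp

end PureNash

/-! ### The equilibrium of the 2-cycle game. -/

section Game

variable {n : ℕ} [NeZero n]

theorem exists_utilityA (x : Fin n → Bool) (v : Vertex n) : ∃ u, utilityA x u v = true := by
  simp only [utilityA, decide_eq_true_eq, edgesA, Set.mem_union, Set.mem_ofPred_eq]
  obtain ⟨i, z⟩ := v
  cases z with
  | l0 =>
    cases h : x i with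
    | false => exact ⟨_, Or.inl (Or.inl (Or.inr ⟨i, h, rfl⟩))⟩
    | true => exact ⟨_, Or.inl (Or.inr ⟨i, h, rfl⟩)⟩
  | l1 => exact ⟨_, Or.inl (Or.inl (Or.inl ⟨i, rfl⟩))⟩
  | l01 => exact ⟨_, Or.inr ⟨i, Or.inl rfl⟩⟩
  | l11 => exact ⟨_, Or.inr ⟨i, Or.inr rfl⟩⟩

theorem exists_utilityB (y : Fin n → Bool) (u : Vertex n) : ∃ v, utilityB y u v = true := by
  simp only [utilityB, decide_eq_true_eq, edgesB, Set.mem_union, Set.mem_ofPred_eq]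
  obtain ⟨i, z⟩ := u
  cases z with
  | l0 => exact ⟨_, Or.inl (Or.inr ⟨i, rfl⟩)⟩
  | l1 => exact ⟨_, Or.inl (Or.inl ⟨i, rfl⟩)⟩
  | l01 => exact ⟨_, Or.inr ⟨i, Or.inl rfl⟩⟩
  | l11 => exact ⟨_, Or.inr ⟨i, Or.inr rfl⟩⟩

theorem Label.ofBit_eq_l0_or_l1 (b : Bool) :
    Label.ofBit b = Label.l0 ∨ Label.ofBit b = Label.l1 := by
  cases b <;> simp [Label.ofBit]

theorem fin_add_one_ne (hn : 3 ≤ n) (i : Fin n) : i + 1 ≠ i := by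
  obtain ⟨m, rfl⟩ : ∃ m, n = m + 3 := ⟨n - 3, by omega⟩
  intro h
  simp at h

theorem fin_add_one_add_one_ne (hn : 3 ≤ n) (i : Fin n) : i + 1 + 1 ≠ i := by
  obtain ⟨m, rfl⟩ : ∃ m, n = m + 3 := ⟨n - 3, by omega⟩
  intro h
  have h1 : (1 + 1 : Fin (m + 3)) = 0 := by
    rw [add_assoc] at h
    simpa using h
  have h2 := congrArg Fin.val h1
  simp [Fin.val_add, Nat.mod_eq_of_lt (show 2 < m + 3 by omega)] at h2

/-- All edges of `B`, and all but one kind of `A`, keep the index or raise it by one. For `n ≥ 3`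
two such edges cannot close up: indices clash, or labels do when both stay. Only the backward edge
of `A` out of `(i, 0)` with `x i = 1` remains, and `B` returns to `(i, 0)` exactly when `y i = 0`.
-/
theorem utilities_eq_true_iff (hn : 3 ≤ n) (x y : Fin n → Bool) (u v : Vertex n) :
    utilityA x u v = true ∧ utilityB y u v = true ↔
      ∃ i, x i > y i ∧ v = (i, Label.l0) ∧ u = (i - 1, Label.ofBit (x (i - 1))) := by
  obtain ⟨j, c⟩ := u
  obtain ⟨i, d⟩ := v
  have e1 := fin_add_one_ne hn
  have e2 := fin_add_one_add_one_ne hn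
  have hgt : ∀ k, x k > y k ↔ x k = true ∧ y k = false := fun k => by
    cases x k <;> cases y k <;> decide
  simp only [utilityA, utilityB, decide_eq_true_eq, edgesA, edgesB, Set.mem_union,
    Set.mem_ofPred_eq, hgt, Prod.mk.injEq]
  constructor
  · rintro ⟨hA, hB⟩
    have hB' : (j = i ∧ (c = Label.l01 ∨ c = Label.l11) ∧ d = Label.l1) ∨ (i = j + 1 ∧
        (d = Label.l0 ∧ y i = false ∨ d = Label.l01 ∨ d = Label.l11)) := by
      rcases hB with (⟨k, ⟨rfl, rfl⟩, rfl, rfl⟩ | ⟨k, ⟨rfl, rfl⟩, rfl, rfl⟩) |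
        ⟨k, ⟨⟨rfl, rfl⟩, rfl, rfl⟩ | ⟨⟨rfl, rfl⟩, rfl, rfl⟩⟩
      · right
        split_ifs with h <;> simp [h]
      · right
        split_ifs with h <;> simp [h]
      · simp
      · simp
    rcases hA with ((⟨k, ⟨rfl, rfl⟩, rfl, rfl⟩ | ⟨k, hk, ⟨rfl, rfl⟩, rfl, rfl⟩) |
      ⟨k, hk, ⟨rfl, rfl⟩, rfl, rfl⟩) | ⟨k, ⟨⟨rfl, rfl⟩, rfl, rfl⟩ | ⟨⟨rfl, rfl⟩, rfl, rfl⟩⟩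
    · rcases hB' with ⟨h, -⟩ | ⟨h, -⟩
      · exact absurd h (e1 _)
      · exact absurd h.symm (e2 _)
    · rcases hB' with ⟨h, -⟩ | ⟨h, -⟩
      · exact absurd h (e1 _)
      · exact absurd h.symm (e2 _)
    · rcases hB' with ⟨h, -, h'⟩ | ⟨h, h' | h' | h'⟩
      · cases h'
      · exact ⟨i, ⟨hk, h'.2⟩, ⟨rfl, rfl⟩, rfl, rfl⟩
      · cases h'
      · cases h'
    · rcases hB' with ⟨-, h, -⟩ | ⟨h, -⟩
      · simp at h
      · exact absurd h.symm (e1 _)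
    · rcases hB' with ⟨-, h, -⟩ | ⟨h, -⟩
      · simp at h
      · exact absurd h.symm (e1 _)
  · rintro ⟨k, ⟨hx, hy⟩, ⟨rfl, rfl⟩, rfl, rfl⟩
    refine ⟨Or.inl (Or.inr ⟨i, hx, ⟨rfl, rfl⟩, rfl, rfl⟩), Or.inl ?_⟩
    rcases Label.ofBit_eq_l0_or_l1 (x (i - 1)) with h | h
    · exact Or.inr ⟨i - 1, ⟨rfl, h⟩, by simp, by simp [hy]⟩
    · exact Or.inl ⟨i - 1, ⟨rfl, h⟩, by simp, by simp [hy]⟩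

theorem isPureNash_utilities_iff (hn : 3 ≤ n) (x y : Fin n → Bool) (u v : Vertex n) :
    IsPureNash (utilityA x) (utilityB y) u v ↔
      ∃ i, x i > y i ∧ v = (i, Label.l0) ∧ u = (i - 1, Label.ofBit (x (i - 1))) := by
  rw [isPureNash_iff (exists_utilityA x) (exists_utilityB y), utilities_eq_true_iff hn]

theorem existsUnique_isPureNash (hn : 3 ≤ n) {uA uB : Vertex n → Vertex n → Bool}
    (h : IsTwoCycleGame uA uB) : ∃! p : Vertex n × Vertex n, IsPureNash uA uB p.1 p.2 := by
  obtain ⟨x, y, ⟨i, hi, huniq⟩, rfl, rfl⟩ := h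
  refine ⟨((i - 1, Label.ofBit (x (i - 1))), (i, Label.l0)),
    (isPureNash_utilities_iff hn _ _ _ _).2 ⟨i, hi, rfl, rfl⟩, ?_⟩
  rintro ⟨u, v⟩ huv
  obtain ⟨j, hj, rfl, rfl⟩ := (isPureNash_utilities_iff hn _ _ _ _).1 huv
  rw [huniq j hj]

end Game

/-! ### Amplification, and corruption for sums of rectangles. -/

section RectangleCorruption

theorem subsetSum_one {V : Type*} (S : Finset V) : subsetSum (fun _ => 1) S = 2 ^ S.card := by
  simp [subsetSum, Finset.card_powerset]

/-- Iterated choice of functions that are small on average on a finite family of pairs. -/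
theorem exists_isRectSum_pow {V ι : Type*} {s : Finset ι} {X Z : ι → Finset V} {m : ℕ} {δ : ℝ}
    (hδ : 0 ≤ δ)
    (hstep : ∀ w : ι → ℝ, (∀ p ∈ s, 0 ≤ w p) → ∃ F : Finset V → Finset V → ℝ, IsRectSum m F ∧
      (∀ x z, 0 ≤ F x z) ∧ (∀ x z, Disjoint x z → F x z = 1) ∧
      ∑ p ∈ s, w p * F (X p) (Z p) ≤ δ * ∑ p ∈ s, w p) (k : ℕ) :
    ∃ F : Finset V → Finset V → ℝ, IsRectSum (m ^ k) F ∧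
      (∀ x z, 0 ≤ F x z) ∧ (∀ x z, Disjoint x z → F x z = 1) ∧
      ∑ p ∈ s, F (X p) (Z p) ≤ δ ^ k * s.card := by
  induction k with
  | zero => exact ⟨fun _ _ => 1, isRectSum_one, by simp, by simp, by simp⟩
  | succ k ih =>
    obtain ⟨F, hF, hF0, hF1, hFs⟩ := ih
    -- Weighting the pairs by the product so far makes the next factor small where it is still
    -- needed; this replaces independent repetitions.
    obtain ⟨G, hG, hG0, hG1, hGs⟩ := hstep (fun p => F (X p) (Z p)) fun p _ => hF0 _ _
    refine ⟨fun x z => F x z * G x z, hF.mul hG, fun x z => mul_nonneg (hF0 x z) (hG0 x z),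
      fun x z h => by simp only [hF1 x z h, hG1 x z h, one_mul], hGs.trans ?_⟩
    calc δ * ∑ p ∈ s, F (X p) (Z p) ≤ δ * (δ ^ k * s.card) := mul_le_mul_of_nonneg_left hFs hδ
      _ = δ ^ (k + 1) * s.card := by ring

variable {V : Type*} [DecidableEq V] [Fintype V]

theorem disjSum_sum {ι : Type*} [Fintype ι] (F : ι → Finset V → Finset V → ℝ) :
    disjSum (fun x z => ∑ j, F j x z) = ∑ j, disjSum (F j) := by
  refine (Finset.sum_congr rfl fun S _ => ?_).trans Finset.sum_comm
  exact (Finset.sum_congr rfl fun x _ => Finset.sum_comm).trans Finset.sum_comm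

theorem meetSum_sum {ι : Type*} [Fintype ι] (F : ι → Finset V → Finset V → ℝ) :
    meetSum (fun x z => ∑ j, F j x z) = ∑ j, meetSum (F j) := by
  refine (Finset.sum_congr rfl fun i _ => ?_).trans Finset.sum_comm
  refine (Finset.sum_congr rfl fun S _ => ?_).trans Finset.sum_comm
  exact (Finset.sum_congr rfl fun x _ => Finset.sum_comm).trans Finset.sum_comm

theorem disjSum_eq_of_disjoint {F : Finset V → Finset V → ℝ} (hF : ∀ x z, Disjoint x z → F x z = 1) :
    disjSum F = 4 ^ Fintype.card V := by
  have h1 : disjSum F = disjSum (fun x z : Finset V => (fun _ => 1) x * (fun _ => 1) z) := by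
    refine Finset.sum_congr rfl fun S _ => Finset.sum_congr rfl fun x hx =>
      Finset.sum_congr rfl fun z hz => ?_
    rw [hF x z (Disjoint.mono (Finset.mem_powerset.1 hx) (Finset.mem_powerset.1 hz)
      disjoint_compl_right)]
    norm_num
  rw [h1, disjSum_mul]
  simp_rw [subsetSum_one, ← pow_add, Finset.card_add_card_compl]
  rw [Finset.sum_const, Finset.card_univ, Fintype.card_finset, nsmul_eq_mul]
  push_cast
  rw [← mul_pow]
  norm_num

/-- For each `i` there are `2 ^ (n - 1)` sets `S`, and each admits `2 ^ (n - 1)` pairs, since `S`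
and `(insert i S)ᶜ` together have `n - 1` elements. -/
theorem four_mul_meetSum_one :
    4 * meetSum (fun _ _ : Finset V => (1 : ℝ)) = Fintype.card V * 4 ^ Fintype.card V := by
  have h1 := meetSum_mul (V := V) (fun _ => 1) (fun _ => 1)
  simp only [mul_one, subsetSum_one] at h1
  rw [h1]
  have h2 : ∀ i : V, 4 * ∑ S ∈ (Finset.univ.erase i).powerset,
      (2 : ℝ) ^ S.card * 2 ^ (insert i S)ᶜ.card = 4 ^ Fintype.card V := by
    intro i
    have hpos : 0 < Fintype.card V := Fintype.card_pos_iff.2 ⟨i⟩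
    have h3 : ∀ S ∈ (Finset.univ.erase i).powerset,
        (2 : ℝ) ^ S.card * 2 ^ (insert i S)ᶜ.card = 2 ^ (Fintype.card V - 1) := by
      intro S hS
      have hiS : i ∉ S := fun hi => Finset.notMem_erase i _ (Finset.mem_powerset.1 hS hi)
      rw [← pow_add, ← Finset.card_add_card_compl (insert i S), Finset.card_insert_of_notMem hiS]
      congr 1
      omega
    rw [Finset.sum_congr rfl h3, Finset.sum_const, Finset.card_powerset,
      Finset.card_erase_of_mem (Finset.mem_univ i), Finset.card_univ, nsmul_eq_mul]
    obtain ⟨m, hm⟩ : ∃ m, Fintype.card V = m + 1 := ⟨_, (Nat.succ_pred_eq_of_pos hpos).symm⟩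
    rw [hm, show (4 : ℝ) = 2 * 2 by norm_num, mul_pow]
    push_cast
    ring
  rw [Finset.mul_sum, Finset.sum_congr rfl fun i _ => h2 i]
  simp

theorem IsRectSum.corruption {m : ℕ} {F : Finset V → Finset V → ℝ} (hF : IsRectSum m F) :
    Fintype.card V / 2 * disjSum F ≤ 24 * meetSum F +
      m * (10 * (Fintype.card V * 4 ^ Fintype.card V * Real.exp (-(Fintype.card V / 160)))) := by
  obtain ⟨ι, _, f, g, hc, hf, hg, hs⟩ := hF
  obtain rfl : F = fun x z => ∑ j, f j x * g j z := by
    ext x z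
    exact hs x z
  rw [disjSum_sum (fun j x z => f j x * g j z), meetSum_sum (fun j x z => f j x * g j z),
    Finset.mul_sum, Finset.mul_sum]
  have h1 : ((Fintype.card ι : ℕ) : ℝ) ≤ m := by exact_mod_cast hc
  have h2 := Finset.sum_le_sum fun (j : ι) (_ : j ∈ Finset.univ) =>
    TwoCycle.corruption (fun x => (hf j x).1) (fun x => (hf j x).2) (fun z => (hg j z).1)
      (fun z => (hg j z).2)
  refine h2.trans ?_
  rw [Finset.sum_add_distrib, Finset.sum_const, Finset.card_univ, nsmul_eq_mul]
  gcongr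

/-- Flattens the nested sum into one finite family of promise inputs, the form needed to average
over coins. -/
theorem exists_meetSum_eq_sum (V : Type) [DecidableEq V] [Fintype V] :
    ∃ (ι : Type) (s : Finset ι) (X Z : ι → Finset V),
      (∀ p ∈ s, ∃ i, X p ∩ Z p = {i}) ∧ ∀ F, meetSum F = ∑ p ∈ s, F (X p) (Z p) := by
  refine ⟨Σ _ : V, Σ _ : Finset V, Σ _ : Finset V, Finset V,
    Finset.univ.sigma fun i => (Finset.univ.erase i).powerset.sigma fun S =>
      S.powerset.sigma fun _ => (insert i S)ᶜ.powerset,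
    fun p => insert p.1 p.2.2.1, fun p => insert p.1 p.2.2.2, ?_, fun F => ?_⟩
  · rintro ⟨i, S, x, z⟩ hp
    simp only [Finset.mem_sigma, Finset.mem_powerset] at hp
    obtain ⟨-, -, hx, hz⟩ := hp
    refine ⟨i, ?_⟩
    rw [← Finset.insert_inter_distrib]
    have : Disjoint x z := Disjoint.mono (hx.trans (Finset.subset_insert i S)) hz
      disjoint_compl_right
    rw [Finset.disjoint_iff_inter_eq_empty.1 this]
    rfl
  · simp only [meetSum, Finset.sum_sigma]

end RectangleCorruption

/-! ### The communication lower bound. -/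

section LowerBound

theorem decide_gt_decide_iff {n : ℕ} (x z : Finset (Fin n)) (j : Fin n) :
    decide (j ∈ x) > decide (j ∉ z) ↔ j ∈ x ∩ z := by
  rw [Finset.mem_inter]
  by_cases h1 : j ∈ x <;> by_cases h2 : j ∈ z <;> simp [h1, h2]

variable {n : ℕ} [NeZero n]

/-- The randomized protocols whose inputs are utility functions and whose outputs are actions. -/
abbrev TwoCycleProtocol (n : ℕ) : Type 1 :=
  RandomizedProtocol (Vertex n → Vertex n → Bool) (Vertex n → Vertex n → Bool)
    (Vertex n) (Vertex n)

theorem isTwoCycleGame_of_inter {x z : Finset (Fin n)} {i : Fin n} (h : x ∩ z = {i}) :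
    IsTwoCycleGame (utilityA fun j => decide (j ∈ x)) (utilityB fun j => decide (j ∉ z)) := by
  have hmem : ∀ j, (decide (j ∈ x) > decide (j ∉ z)) ↔ j = i := fun j => by
    rw [decide_gt_decide_iff, h, Finset.mem_singleton]
  exact ⟨_, _, ⟨i, (hmem i).2 rfl, fun j hj => (hmem j).1 hj⟩, rfl, rfl⟩

/-- On inputs given by disjoint sets the event counted here has probability one, on inputs with a
unique dispute it is rare for a protocol that solves the game. -/
theorem exists_isRectSum_of_solves (hn : 3 ≤ n) {P : TwoCycleProtocol n}
    (hP : P.Solves IsTwoCycleGame IsPureNash (1 / 3)) {ι : Type*} {s : Finset ι}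
    {X Z : ι → Finset (Fin n)} (hs : ∀ p ∈ s, ∃ i, X p ∩ Z p = {i}) {w : ι → ℝ}
    (hw : ∀ p ∈ s, 0 ≤ w p) :
    ∃ F : Finset (Fin n) → Finset (Fin n) → ℝ,
      IsRectSum (2 ^ P.complexity IsTwoCycleGame * (n + 1) ^ 2) F ∧
      (∀ x z, 0 ≤ F x z) ∧ (∀ x z, Disjoint x z → F x z = 1) ∧
      ∑ p ∈ s, w p * F (X p) (Z p) ≤ 1 / 3 * ∑ p ∈ s, w p := by
  have hgame : ∀ p ∈ s, IsTwoCycleGame (utilityA fun j => decide (j ∈ X p))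
      (utilityB fun j => decide (j ∉ Z p)) := fun p hp => by
    obtain ⟨i, hi⟩ := hs p hp
    exact isTwoCycleGame_of_inter hi
  obtain ⟨ω, hω⟩ := RandomizedProtocol.exists_coins hP s _ _ hgame hw
  set φ : Finset (Fin n) → (Vertex n → Vertex n → Bool) × P.Common × P.PrivA :=
    fun x => (utilityA fun j => decide (j ∈ x), ω.1, ω.2.1) with hφ
  set ψ : Finset (Fin n) → (Vertex n → Vertex n → Bool) × P.Common × P.PrivB :=
    fun z => (utilityB fun j => decide (j ∉ z), ω.1, ω.2.2) with hψ
  -- At the equilibrium the action of `A` has index `i - 1` and that of `B` has index `i`, hence the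
  -- shift by one.
  set a : Finset (Fin n) → Vertex n → Option (Fin n) :=
    fun x u => if u.1 + 1 ∈ x then some (u.1 + 1) else none with ha
  set b : Finset (Fin n) → Vertex n → Option (Fin n) :=
    fun z v => if v.1 ∈ z then some v.1 else none with hb
  refine ⟨P.tree.missed φ ψ a b (P.complexity IsTwoCycleGame), ?_,
    P.tree.missed_nonneg φ ψ a b _, fun x z hxz => P.tree.missed_eq_one φ ψ a b ?_ _,
    le_trans (Finset.sum_le_sum fun p hp => mul_le_mul_of_nonneg_left ?_ (hw p hp)) hω⟩
  · have h := P.tree.isRectSum_missed φ ψ a b (P.complexity IsTwoCycleGame)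
    rwa [Fintype.card_fin] at h
  · intro u v huv
    simp only [ha, hb] at huv ⊢
    split_ifs at huv ⊢ with h1 h2
    · have h3 := Option.some.inj huv
      rw [← h3] at h2
      exact absurd h2 (Finset.disjoint_left.1 hxz h1)
    · rfl
  · rw [P.tree.missed_eq_of_bits_le φ ψ a b _ (P.bits_le_complexity (hgame p hp) ω)]
    split_ifs with h1 h2 h2
    · exact le_rfl
    · exact zero_le_one
    · refine absurd ?_ h1
      obtain ⟨i, hi, hv, hu⟩ := (isPureNash_utilities_iff hn _ _ _ _).1 h2
      have hix : i ∈ X p ∧ i ∈ Z p := Finset.mem_inter.1 ((decide_gt_decide_iff _ _ _).1 hi)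
      have hv' : (P.tree.run (φ (X p)) (ψ (Z p))).2 = _ := hv
      have hu' : (P.tree.run (φ (X p)) (ψ (Z p))).1 = _ := hu
      rw [hv', hu']
      simp [ha, hb, hix]
    · exact le_rfl

theorem exp_le_of_solves (hn : 3 ≤ n) {P : TwoCycleProtocol n}
    (hP : P.Solves IsTwoCycleGame IsPureNash (1 / 3)) :
    Real.exp (n / 160) ≤ 36 * (2 ^ P.complexity IsTwoCycleGame * ((n : ℝ) + 1) ^ 2) ^ 3 := by
  obtain ⟨ι, s, X, Z, hs, hmeet⟩ := exists_meetSum_eq_sum (Fin n)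
  -- Three factors are needed: `24 * (1/4) * (1/3) ^ 3 = 2/9` is below `1/2`, whereas two factors
  -- give `2/3`.
  obtain ⟨F, hF, -, hF1, hFs⟩ := exists_isRectSum_pow (by norm_num)
    (fun w hw => exists_isRectSum_of_solves hn hP hs hw) 3
  have h1 := hF.corruption
  have h2 := four_mul_meetSum_one (V := Fin n)
  rw [disjSum_eq_of_disjoint hF1, hmeet F] at h1
  rw [hmeet] at h2
  simp only [Finset.sum_const, nsmul_eq_mul, mul_one, Fintype.card_fin] at h1 h2
  push_cast at h1
  set M : ℝ := (2 ^ P.complexity IsTwoCycleGame * ((n : ℝ) + 1) ^ 2) ^ 3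
  have hpos : (0 : ℝ) < n * 4 ^ n := by
    have : (0 : ℝ) < n := by exact_mod_cast (by omega : 0 < n)
    positivity
  -- `5/18 = 1/2 - 2/9`; dividing `10` by it gives the final `36`.
  have h3 : (n * 4 ^ n : ℝ) * (5 / 18) ≤ n * 4 ^ n * (10 * M * Real.exp (-(n / 160))) := by
    linarith
  have h4 := le_of_mul_le_mul_left h3 hpos
  rw [Real.exp_neg, ← div_eq_mul_inv, le_div_iff₀ (Real.exp_pos _)] at h4
  linarith

/-- Without communication the output of `A` depends only on `x` and the coins. With `x` everything
and `z = {0}` or `z = {1}`, it is wrong for one of the two, so the errors sum to at least `1 > 2/3`.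
-/
theorem one_le_complexity_of_solves (hn : 3 ≤ n) {P : TwoCycleProtocol n}
    (hP : P.Solves IsTwoCycleGame IsPureNash (1 / 3)) : 1 ≤ P.complexity IsTwoCycleGame := by
  by_contra hC
  have hC0 : P.complexity IsTwoCycleGame = 0 := by omega
  have hne : (1 : Fin n) ≠ 0 := by
    have := fin_add_one_ne hn 0
    rwa [zero_add] at this
  set uA : Vertex n → Vertex n → Bool :=
    utilityA fun j => decide (j ∈ (Finset.univ : Finset (Fin n))) with huA
  set uB : Fin n → Vertex n → Vertex n → Bool :=
    fun i => utilityB fun j => decide (j ∉ ({i} : Finset (Fin n))) with huB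
  have hgame : ∀ i : Fin n, IsTwoCycleGame uA (uB i) := fun i =>
    isTwoCycleGame_of_inter (i := i) (Finset.univ_inter _)
  obtain ⟨ω, hω⟩ := RandomizedProtocol.exists_coins hP ({0, 1} : Finset (Fin n)) (fun _ => uA) uB
    (fun i _ => hgame i) (w := fun _ => 1) (fun _ _ => zero_le_one)
  rw [Finset.sum_pair hne.symm, Finset.sum_pair hne.symm] at hω
  have hbits : P.bits uA (uB 0) ω = 0 :=
    Nat.le_zero.1 (hC0 ▸ P.bits_le_complexity (hgame 0) ω)
  obtain ⟨outA, outB, hT⟩ := ProtocolTree.exists_eq_leaf hbits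
  have key : ∀ i : Fin n, IsPureNash uA (uB i) (P.output uA (uB i) ω).1
      (P.output uA (uB i) ω).2 → (outA (uA, ω.1, ω.2.1)).1 + 1 = i := by
    intro i h
    obtain ⟨k, hk, -, hu⟩ := (isPureNash_utilities_iff hn _ _ _ _).1 h
    obtain rfl : k = i := by
      rw [decide_gt_decide_iff, Finset.univ_inter] at hk
      exact Finset.mem_singleton.1 hk
    simp only [RandomizedProtocol.output, hT, ProtocolTree.run] at hu
    rw [hu]
    simp
  split_ifs at hω with h0 h1 h1
  · exact hne ((key 1 h1).symm.trans (key 0 h0))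
  all_goals norm_num at hω

theorem div_le_of_exp_le {n C : ℕ} (hC : 1 ≤ C)
    (h : Real.exp (n / 160) ≤ 36 * (2 ^ C * ((n : ℝ) + 1) ^ 2) ^ 3) :
    (n : ℝ) / 10 ^ 7 ≤ C := by
  by_contra hlt
  push Not at hlt
  have hC' : (1 : ℝ) ≤ C := by exact_mod_cast hC
  have hn0 : (0 : ℝ) < (n : ℝ) + 1 := by positivity
  have h1 : (n : ℝ) / 160 ≤ Real.log 36 + 3 * (C * Real.log 2 + 2 * Real.log ((n : ℝ) + 1)) := by
    have h2 := (Real.le_log_iff_exp_le (by positivity)).2 h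
    rw [Real.log_mul (by norm_num) (by positivity), Real.log_pow,
      Real.log_mul (by positivity) (by positivity), Real.log_pow, Real.log_pow] at h2
    exact_mod_cast h2
  have h36 : Real.log 36 ≤ 36 - 1 := Real.log_le_sub_one_of_pos (by norm_num)
  have h2 : Real.log 2 ≤ 2 - 1 := Real.log_le_sub_one_of_pos (by norm_num)
  have h2000 : Real.log 2000 ≤ 2000 - 1 := Real.log_le_sub_one_of_pos (by norm_num)
  -- The tangent at `2000` has slope small enough that `6/2000 < 1/160`. The crude additive
  -- constants are absorbed because `1 ≤ C < n / 10 ^ 7` forces `n > 10 ^ 7`.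
  have hlog : Real.log ((n : ℝ) + 1) - Real.log 2000 ≤ ((n : ℝ) + 1) / 2000 - 1 := by
    rw [← Real.log_div hn0.ne' (by norm_num)]
    exact Real.log_le_sub_one_of_pos (by positivity)
  have hCl : C * Real.log 2 ≤ C := mul_le_of_le_one_right (by linarith) (by linarith)
  linarith

end LowerBound

end TwoCycle

theorem mainTheorem6 :
    (∀ (n : ℕ) [NeZero n], 3 ≤ n → ∀ uA uB : TwoCycle.Vertex n → TwoCycle.Vertex n → Bool,
      TwoCycle.IsTwoCycleGame uA uB →
        ∃! p : TwoCycle.Vertex n × TwoCycle.Vertex n, TwoCycle.IsPureNash uA uB p.1 p.2) ∧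
    (∃ c : ℝ, 0 < c ∧ ∀ (n : ℕ) [NeZero n], 3 ≤ n →
      ∀ P : TwoCycle.RandomizedProtocol
          (TwoCycle.Vertex n → TwoCycle.Vertex n → Bool)
          (TwoCycle.Vertex n → TwoCycle.Vertex n → Bool)
          (TwoCycle.Vertex n) (TwoCycle.Vertex n),
        P.Solves TwoCycle.IsTwoCycleGame TwoCycle.IsPureNash (1 / 3) →
          c * (4 * (n : ℝ)) ≤ (P.complexity TwoCycle.IsTwoCycleGame : ℝ)) := by
  refine ⟨fun n _ hn uA uB h => TwoCycle.existsUnique_isPureNash hn h,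
    1 / (4 * 10 ^ 7), by norm_num, fun n _ hn P hP => ?_⟩
  have h := TwoCycle.div_le_of_exp_le (TwoCycle.one_le_complexity_of_solves hn hP)
    (TwoCycle.exp_le_of_solves hn hP)
  linarith
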